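/- Let $G$ be a locally compact (Hausdorff) group with left Haar measure $dx$, and let $w : G \to (0,\infty)$ be a weight, i.e. a Borel measurable function with $w(xy) \le w(x)w(y)$ for all $x,y \in G$. Assume that either $w$ is constant on the conjugacy classes of $G$, or $w(x) \ge 1$ for all $x \in G$. Let $A$ be a complex Banach algebra (not necessarily unital) with center $\mathcal{Z}(A)$, and assume that $A$ has a bounded $\mathcal{Z}(A)$-approximate identity, i.e. a bounded net $(a_\alpha)$ in $A$ such that $a_\alpha a \to a$ for every $a \in \mathcal{Z}(A)$. Let $L^1_w(G,A)$ be the Banach algebra of (a.e.-classes of) measurable functions $f : G \to A$ with $\int_G \|f(x)\|\,w(x)\,dx < \infty$, with multiplication $(f*g)(x) = \int_G f(xy)\,g(y^{-1})\,dy$, and let $\mathcal{Z}(L^1_w(G,A))$ be its center. If $\mathcal{Z}(L^1_w(G,A)) \neq \{0\}$, then $G$ is an $[\mathrm{IN}]$ group, i.e. the identity of $G$ has a compact neighbourhood that is invariant under all inner automorphisms of $G$. -/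

import Mathlib

open MeasureTheory Filter Topology

/-- A weight on `G`: a Borel measurable, strictly positive, submultiplicative function. -/
structure IsWeight {G : Type*} [Group G] [MeasurableSpace G] (w : G → ℝ) : Prop where
  measurable : Measurable w
  pos : ∀ x, 0 < w x
  mul_le : ∀ x y, w (x * y) ≤ w x * w y

/-- The measure `w dx`. -/
noncomputable def weightedMeasure {G : Type*} [MeasurableSpace G] (μ : Measure G) (w : G → ℝ) :
    Measure G :=
  μ.withDensity (fun x => ENNReal.ofReal (w x))

/-- The space `L¹_w(G, A)`: classes, modulo equality almost everywhere, of (strongly) measurable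
functions `f : G → A` with `∫ ‖f x‖ w x dx < ∞`. -/
noncomputable abbrev BeurlingSpace {G : Type*} [MeasurableSpace G] (μ : Measure G) (w : G → ℝ)
    (A : Type*) [NormedAddCommGroup A] :=
  Lp A 1 (weightedMeasure μ w)

/-- The convolution `(f * g)(x) = ∫ f (x y) g (y⁻¹) dy`, the multiplication of `L¹_w(G, A)`. -/
noncomputable def beurlingConv {G : Type*} [Group G] [MeasurableSpace G] (μ : Measure G)
    {A : Type*} [NonUnitalNormedRing A] [NormedSpace ℂ A] (f g : G → A) : G → A :=
  fun x => ∫ y, f (x * y) * g y⁻¹ ∂μ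

/-- The center of `L¹_w(G, A)`: the elements that commute with every element under convolution.
The two products are compared as elements of `L¹_w(G, A)`, that is, almost everywhere. -/
def beurlingCenter {G : Type*} [Group G] [MeasurableSpace G] (μ : Measure G) (w : G → ℝ)
    (A : Type*) [NonUnitalNormedRing A] [NormedSpace ℂ A] : Set (BeurlingSpace μ w A) :=
  {f | ∀ g : BeurlingSpace μ w A,
    beurlingConv μ (f : G → A) (g : G → A) =ᵐ[weightedMeasure μ w]
      beurlingConv μ (g : G → A) (f : G → A)}

/-- A bounded `Z(A)`-approximate identity: a bounded net `a` in `A` with `a i * z → z` for every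
`z` in the center of `A`. -/
def IsBoundedCenterApproxIdentity {A : Type*} [NonUnitalNormedRing A]
    {ι : Type*} [Preorder ι] (a : ι → A) : Prop :=
  (∃ M : ℝ, ∀ i, ‖a i‖ ≤ M) ∧ ∀ z ∈ Set.center A, Tendsto (fun i => a i * z) atTop (𝓝 z)

/-- `G` is an [IN] group: the identity has a compact neighbourhood which is invariant under all
inner automorphisms. -/
def IsINGroup (G : Type*) [Group G] [TopologicalSpace G] : Prop :=
  ∃ K : Set G, K ∈ 𝓝 (1 : G) ∧ IsCompact K ∧ ∀ g : G, (fun x => g * x * g⁻¹) '' K = K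

/-! If `f` is central, comparing `f * (φ ⊗ b)` with `(φ ⊗ b) * f` for test functions `φ` shows that
the vector measure `f(y)b dy` is invariant under conjugation, so every inner automorphism multiplies
`f b` by a constant (a value of the Haar modulus). Multiplying `f b` by a class function `v ≤ w`,
namely `w` or `1`, yields an integrable function `h` with the same property. Such an automorphism
then preserves the distance `x ↦ ‖h - λ_x h‖₁` from `h` to its left translate `λ_x h`. This distance
is small near `1` and close to `2‖h‖₁` off a compact set, so `{x | ‖h - λ_x h‖₁ ≤ ‖h‖₁}` is a
relatively compact neighbourhood of `1` invariant under conjugation.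

Some `f b` is nonzero: otherwise all integrals `∫_s f` are central elements of `A` annihilated by
`A`, and vanish because of the approximate identity.

`G` need not be σ-compact, so the Radon–Nikodym theorem is not available to relate Haar measure to
its image under inversion; the explicit continuous density of a right invariant measure replaces
it. -/

section RegularMeasure

variable {X : Type*} [TopologicalSpace X] [T2Space X] [LocallyCompactSpace X] [MeasurableSpace X]
  [BorelSpace X] {μ : Measure X} [μ.Regular] {E : Type*} [NormedAddCommGroup E] [NormedSpace ℝ E]

theorem exists_hasCompactSupport_abs_sub_indicator_le {s : Set X} (hs : MeasurableSet s)
    (hμs : μ s ≠ ⊤) {δ : ENNReal} (hδ : δ ≠ 0) :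
    ∃ (ψ : C(X, ℝ)) (T : Set X), HasCompactSupport ψ ∧ MeasurableSet T ∧ μ T < δ ∧
      ∀ y, |ψ y - s.indicator 1 y| ≤ T.indicator 1 y := by
  have hδ2 : δ / 2 ≠ 0 := (ENNReal.half_pos hδ).ne'
  obtain ⟨U, hsU, hU, -, hUs⟩ := hs.exists_isOpen_sdiff_lt hμs hδ2
  obtain ⟨K, hKs, hK, hsK⟩ := hs.exists_isCompact_sdiff_lt hμs hδ2
  obtain ⟨ψ, hψK, hψc, hψU, hψ⟩ :=
    exists_continuousMap_one_of_isCompact_subset_isOpen hK hU (hKs.trans hsU)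
  refine ⟨ψ, U \ K, hψc, hU.measurableSet.diff hK.measurableSet, ?_, fun y => ?_⟩
  · calc μ (U \ K) ≤ μ ((U \ s) ∪ (s \ K)) := measure_mono (sdiff_triangle U s K)
      _ ≤ μ (U \ s) + μ (s \ K) := measure_union_le _ _
      _ < δ / 2 + δ / 2 := ENNReal.add_lt_add hUs hsK
      _ = δ := ENNReal.add_halves δ
  · obtain ⟨h0, h1⟩ := hψ y
    by_cases hyK : y ∈ K
    · simp [show ψ y = 1 from hψK hyK, hKs hyK, hyK]
    by_cases hyU : y ∈ U
    · have hyUK : y ∈ U \ K := ⟨hyU, hyK⟩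
      rw [Set.indicator_of_mem hyUK, Pi.one_apply, abs_le]
      by_cases hys : y ∈ s
      · rw [Set.indicator_of_mem hys, Pi.one_apply]
        constructor <;> linarith
      · rw [Set.indicator_of_notMem hys]
        constructor <;> linarith
    · have hys : y ∉ s := fun h => hyU (hsU h)
      simp [image_eq_zero_of_notMem_tsupport fun h => hyU (hψU h), hyU, hys]

theorem exists_hasCompactSupport_integral_norm_sub_le {h : X → E} (hh : Integrable h μ) {ε : ℝ}
    (hε : 0 < ε) :
    ∃ k : X → E, Continuous k ∧ HasCompactSupport k ∧ ∫ x, ‖h x - k x‖ ∂μ ≤ ε := by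
  obtain ⟨k, hle, hk, hk'⟩ : ∃ k : X → E, eLpNorm (h - k) 1 μ ≤ ENNReal.ofReal ε ∧
      Continuous k ∧ HasCompactSupport k := by
    refine (memLp_one_iff_integrable.2 hh).induction_dense ENNReal.one_ne_top _
      (fun c s hs hμs ε hε => ?_) (fun f g hf hg => ⟨hf.1.add hg.1, hf.2.add hg.2⟩)
      (fun f hf => (hf.1.integrable_of_hasCompactSupport hf.2).aestronglyMeasurable)
      (ENNReal.ofReal_pos.2 hε).ne'
    obtain ⟨η, hη, hsmall⟩ := exists_eLpNorm_indicator_le (μ := μ) ENNReal.one_ne_top c hε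
    obtain ⟨ψ, T, hψ, -, hT, hψT⟩ :=
      exists_hasCompactSupport_abs_sub_indicator_le hs hμs.ne (ENNReal.coe_pos.2 hη).ne'
    refine ⟨fun y => ψ y • c, (eLpNorm_mono fun y => ?_).trans (hsmall T hT.le),
      by fun_prop, hψ.smul_right⟩
    have hs' : s.indicator (fun _ => c) y = s.indicator (1 : X → ℝ) y • c := by
      by_cases hy : y ∈ s <;> simp [hy]
    have hT' : ‖T.indicator (fun _ => c) y‖ = T.indicator (1 : X → ℝ) y * ‖c‖ := by
      by_cases hy : y ∈ T <;> simp [hy]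
    rw [Pi.sub_apply, hs', hT', ← sub_smul, norm_smul, Real.norm_eq_abs]
    gcongr
    exact hψT y
  have hi : Integrable (h - k) μ := hh.sub (hk.integrable_of_hasCompactSupport hk')
  refine ⟨k, hk, hk', (integral_norm_eq_lintegral_enorm hi.1).trans_le ?_⟩
  rw [← eLpNorm_one_eq_lintegral_enorm]
  exact ENNReal.toReal_le_of_le_ofReal hε.le hle

theorem ae_eq_zero_of_integral_hasCompactSupport_smul [CompleteSpace E] {F : X → E}
    (hF : Integrable F μ)
    (h : ∀ ψ : X → ℝ, Continuous ψ → HasCompactSupport ψ → ∫ y, ψ y • F y ∂μ = 0) :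
    F =ᵐ[μ] 0 := by
  refine hF.ae_eq_zero_of_forall_setIntegral_eq_zero fun s hs hμs => norm_le_zero_iff.1 ?_
  refine le_of_forall_pos_le_add fun ε hε => (zero_add ε).symm ▸ ?_
  obtain ⟨δ, hδ, hsmall⟩ := exists_pos_setLIntegral_lt_of_measure_lt
    hF.2.ne (ENNReal.ofReal_pos.2 hε).ne'
  obtain ⟨ψ, T, hψc, hTm, hT, hψT⟩ :=
    exists_hasCompactSupport_abs_sub_indicator_le hs hμs.ne hδ.ne'
  have hψF : Integrable (fun y => ψ y • F y) μ :=
    hF.locallyIntegrable.integrable_smul_left_of_hasCompactSupport ψ.continuous hψc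
  calc ‖∫ y in s, F y ∂μ‖ = ‖∫ y, (ψ y • F y - s.indicator F y) ∂μ‖ := by
        rw [integral_sub hψF (hF.indicator hs), h ψ ψ.continuous hψc, integral_indicator hs,
          zero_sub, norm_neg]
    _ ≤ ∫ y in T, ‖F y‖ ∂μ := by
        rw [← integral_indicator hTm]
        refine norm_integral_le_of_norm_le (hF.norm.indicator hTm) (.of_forall fun y => ?_)
        have hs' : s.indicator F y = s.indicator (1 : X → ℝ) y • F y := by
          by_cases hy : y ∈ s <;> simp [hy]
        have hT' : T.indicator (fun y => ‖F y‖) y = T.indicator (1 : X → ℝ) y * ‖F y‖ := by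
          by_cases hy : y ∈ T <;> simp [hy]
        rw [hs', hT', ← sub_smul, norm_smul, Real.norm_eq_abs]
        gcongr
        exact hψT y
    _ ≤ ε := by
        rw [integral_norm_eq_lintegral_enorm hF.1.restrict]
        exact ENNReal.toReal_le_of_le_ofReal hε.le (hsmall _ hT).le

theorem ae_smul_eq_zero_of_integral_hasCompactSupport_smul [CompleteSpace E] {F : X → E}
    (hF : LocallyIntegrable F μ)
    (h : ∀ ψ : X → ℝ, Continuous ψ → HasCompactSupport ψ → ∫ y, ψ y • F y ∂μ = 0)
    {χ : X → ℝ} (hχ : Continuous χ) (hχ' : HasCompactSupport χ) : ∀ᵐ y ∂μ, χ y • F y = 0 :=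
  ae_eq_zero_of_integral_hasCompactSupport_smul
    (hF.integrable_smul_left_of_hasCompactSupport hχ hχ') fun ψ hψ hψ' => by
      simpa only [mul_smul] using h (fun y => ψ y * χ y) (hψ.mul hχ) hψ'.mul_right

theorem ae_eq_zero_of_ae_hasCompactSupport_smul_eq_zero [CompleteSpace E] {F : X → E} {u : X → ℝ}
    (hu : ∀ x, u x ≠ 0) (hF : Integrable (fun y => u y • F y) μ)
    (h : ∀ χ : X → ℝ, Continuous χ → HasCompactSupport χ → ∀ᵐ y ∂μ, χ y • F y = 0) :
    F =ᵐ[μ] 0 := by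
  have huF := ae_eq_zero_of_integral_hasCompactSupport_smul hF fun χ hχ hχ' =>
    integral_eq_zero_of_ae <| (h χ hχ hχ').mono fun y hy => by
      simp only [smul_comm (χ y), hy, smul_zero, Pi.zero_apply]
  exact huF.mono fun y hy => (smul_eq_zero.1 hy).resolve_left (hu y)

end RegularMeasure

section Comparison

variable {X : Type*} [TopologicalSpace X] [T2Space X] [LocallyCompactSpace X] [MeasurableSpace X]
  [BorelSpace X]

theorem measure_le_of_integral_hasCompactSupport_le {μ ν : Measure X} [μ.OuterRegular] [ν.Regular]
    {U : Set X} (hU : IsOpen U)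
    (h : ∀ ψ : X → ℝ, Continuous ψ → HasCompactSupport ψ → 0 ≤ ψ → tsupport ψ ⊆ U →
      ∫ y, ψ y ∂ν ≤ ∫ y, ψ y ∂μ) {s : Set X} (hs : s ⊆ U) : ν s ≤ μ s := by
  rw [s.measure_eq_iInf_isOpen μ]
  refine le_iInf₂ fun V hsV => le_iInf fun hV => ?_
  calc ν s ≤ ν (U ∩ V) := measure_mono (Set.subset_inter hs hsV)
    _ ≤ μ (U ∩ V) := by
      rw [(hU.inter hV).measure_eq_iSup_isCompact]
      refine iSup₂_le fun K hKU => iSup_le fun hK => ?_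
      obtain ⟨ψ, hψK, hψc, hψU, hψ⟩ :=
        exists_continuousMap_one_of_isCompact_subset_isOpen hK (hU.inter hV) hKU
      calc ν K ≤ ENNReal.ofReal (∫ y, ψ y ∂ν) :=
            (ψ.continuous.integrable_of_hasCompactSupport hψc).measure_le_integral
              (.of_forall fun y => (hψ y).1) fun y hy => (hψK hy).ge
        _ ≤ ENNReal.ofReal (∫ y, ψ y ∂μ) := ENNReal.ofReal_le_ofReal <|
            h ψ ψ.continuous hψc (fun y => (hψ y).1) (hψU.trans Set.inter_subset_left)
        _ ≤ μ (U ∩ V) := integral_le_measure (fun y _ => (hψ y).2) fun y hy =>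
            (image_eq_zero_of_notMem_tsupport fun h => hy (hψU h)).le
    _ ≤ μ V := measure_mono Set.inter_subset_right

end Comparison

section Automorphism

variable {G : Type*} [Group G] [TopologicalSpace G] [IsTopologicalGroup G]

/-- Conjugation by `t` as an automorphism of the topological group `G`. -/
def conjContinuousMulEquiv (t : G) : G ≃ₜ* G where
  toMulEquiv := MulAut.conj t
  continuous_toFun := (by fun_prop : Continuous fun y => t * y * t⁻¹)
  continuous_invFun := (by fun_prop : Continuous fun y => t⁻¹ * y * t)

@[simp]
theorem conjContinuousMulEquiv_apply (t y : G) : conjContinuousMulEquiv t y = t * y * t⁻¹ := rfl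

theorem isINGroup_of_conj_invariant_set {K L : Set G} (hK : K ∈ 𝓝 (1 : G)) (hL : IsCompact L)
    (hKL : K ⊆ L) (hinv : ∀ t : G, ∀ x ∈ K, t * x * t⁻¹ ∈ K) : IsINGroup G := by
  refine ⟨closure K, mem_of_superset hK subset_closure, hL.closure_of_subset hKL, fun g => ?_⟩
  have hsub (t : G) : ∀ x ∈ closure K, t * x * t⁻¹ ∈ closure K := fun x hx =>
    map_mem_closure (f := fun x => t * x * t⁻¹) (by fun_prop) hx (hinv t)
  refine Set.Subset.antisymm (Set.image_subset_iff.2 (hsub g)) fun x hx => ?_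
  exact ⟨g⁻¹ * x * g, by simpa using hsub g⁻¹ x hx, by group⟩

variable [MeasurableSpace G] [BorelSpace G] [LocallyCompactSpace G] {μ : Measure G}
  [μ.IsHaarMeasure] [μ.Regular]

theorem mulEquivHaarChar_smul_integral_comp (φ : G ≃ₜ* G) {E : Type*} [NormedAddCommGroup E]
    [NormedSpace ℝ E] (F : G → E) : mulEquivHaarChar φ • ∫ y, F (φ y) ∂μ = ∫ y, F y ∂μ := by
  calc mulEquivHaarChar φ • ∫ y, F (φ y) ∂μ = mulEquivHaarChar φ • ∫ y, F y ∂μ.map φ :=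
        congrArg _ (φ.toHomeomorph.measurableEmbedding.integral_map F).symm
    _ = ∫ y, F y ∂μ := by rw [← integral_smul_nnreal_measure, mulEquivHaarChar_smul_map]

theorem integrable_comp_continuousMulEquiv (φ : G ≃ₜ* G) {E : Type*} [NormedAddCommGroup E]
    {F : G → E} (hF : Integrable F μ) : Integrable (fun y => F (φ y)) μ := by
  have hmap : μ.map φ = (mulEquivHaarChar φ)⁻¹ • μ := by
    rw [eq_inv_smul_iff₀ (mulEquivHaarChar_pos φ).ne', mulEquivHaarChar_smul_map]
  exact φ.toHomeomorph.measurableEmbedding.integrable_map_iff.1 (hmap ▸ hF.smul_measure_nnreal)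

end Automorphism

section TranslateDist

variable {G E : Type*} [Group G] [NormedAddCommGroup E]

/-- The `L¹`-distance between `h` and its left translate by `x`. -/
noncomputable def translateDist [MeasurableSpace G] (μ : Measure G) (h : G → E) (x : G) : ℝ :=
  ∫ y, ‖h y - h (x⁻¹ * y)‖ ∂μ

section Invariant

variable [MeasurableSpace G] [MeasurableMul G] {μ : Measure G} [μ.IsMulLeftInvariant] {h k : G → E}

theorem abs_translateDist_sub_le (hh : Integrable h μ) (hk : Integrable k μ) (x : G) :
    |translateDist μ h x - translateDist μ k x| ≤ 2 * ∫ y, ‖h y - k y‖ ∂μ := by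
  have hh' := hh.comp_mul_left x⁻¹
  have hk' := hk.comp_mul_left x⁻¹
  calc |translateDist μ h x - translateDist μ k x|
      = |∫ y, (‖h y - h (x⁻¹ * y)‖ - ‖k y - k (x⁻¹ * y)‖) ∂μ| :=
        congrArg _ (integral_sub (hh.sub hh').norm (hk.sub hk').norm).symm
    _ ≤ ∫ y, (‖h y - k y‖ + ‖h (x⁻¹ * y) - k (x⁻¹ * y)‖) ∂μ := by
        rw [← Real.norm_eq_abs]
        refine norm_integral_le_of_norm_le ((hh.sub hk).norm.add (hh'.sub hk').norm)
          (.of_forall fun y => ?_)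
        calc |‖h y - h (x⁻¹ * y)‖ - ‖k y - k (x⁻¹ * y)‖|
            ≤ ‖h y - h (x⁻¹ * y) - (k y - k (x⁻¹ * y))‖ := abs_norm_sub_norm_le _ _
          _ ≤ ‖h y - k y‖ + ‖h (x⁻¹ * y) - k (x⁻¹ * y)‖ := by
              rw [sub_sub_sub_comm]
              exact norm_sub_le _ _
    _ = 2 * ∫ y, ‖h y - k y‖ ∂μ := by
        refine (integral_add (hh.sub hk).norm (hh'.sub hk').norm).trans ?_
        rw [two_mul]
        exact congrArg _ (integral_mul_left_eq_self (fun y => ‖h y - k y‖) x⁻¹)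

open scoped Pointwise in
theorem translateDist_of_notMem_support_div (hk : Integrable k μ) {x : G}
    (hx : x ∉ Function.support k / Function.support k) :
    translateDist μ k x = 2 * ∫ y, ‖k y‖ ∂μ := by
  have hnorm (y : G) : ‖k y - k (x⁻¹ * y)‖ = ‖k y‖ + ‖k (x⁻¹ * y)‖ := by
    by_cases hy : k y = 0
    · simp [hy]
    · have hxy : k (x⁻¹ * y) = 0 := by
        by_contra hxy
        exact hx ⟨y, hy, x⁻¹ * y, hxy, by simp [div_eq_mul_inv]⟩
      simp [hxy]
  simp_rw [translateDist, hnorm]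
  rw [integral_add hk.norm (hk.comp_mul_left x⁻¹).norm,
    integral_mul_left_eq_self (fun y => ‖k y‖) x⁻¹, two_mul]

end Invariant

variable [TopologicalSpace G] [IsTopologicalGroup G] [LocallyCompactSpace G] [MeasurableSpace G]
  [BorelSpace G] {μ : Measure G}

open scoped Pointwise in
theorem continuous_translateDist [IsFiniteMeasureOnCompacts μ] {k : G → E} (hk : Continuous k)
    (hk' : HasCompactSupport k) : Continuous (translateDist μ k) := by
  refine continuous_iff_continuousAt.2 fun x₀ => ?_
  obtain ⟨t, ht, hx₀⟩ := exists_compact_mem_nhds x₀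
  refine ContinuousOn.continuousAt (s := t) ?_ hx₀
  refine continuousOn_integral_of_compact_support (hk'.isCompact.union (ht.mul hk'.isCompact))
    (by fun_prop) fun x y hx hy => ?_
  rw [Set.mem_union, not_or] at hy
  have hy0 : k y = 0 := image_eq_zero_of_notMem_tsupport hy.1
  have hxy0 : k (x⁻¹ * y) = 0 :=
    image_eq_zero_of_notMem_tsupport fun h => hy.2 ⟨x, hx, x⁻¹ * y, h, by simp⟩
  simp [hy0, hxy0]

variable [μ.IsHaarMeasure] [μ.Regular] [NormedSpace ℝ E] {h : G → E}

/-- The automorphism scales `μ` and the function by reciprocal constants, because it preserves the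
nonzero integral of the norm. -/
theorem translateDist_continuousMulEquiv (hpos : 0 < ∫ y, ‖h y‖ ∂μ) {φ : G ≃ₜ* G} {c : ℝ}
    (hc : ∀ᵐ y ∂μ, h (φ y) = c • h y) (x : G) : translateDist μ h (φ x) = translateDist μ h x := by
  have hχc : mulEquivHaarChar φ * |c| = 1 := by
    have hnorm : ∫ y, ‖h (φ y)‖ ∂μ = |c| * ∫ y, ‖h y‖ ∂μ := by
      rw [← integral_const_mul]
      exact integral_congr_ae (hc.mono fun y hy => by simp only [hy, norm_smul, Real.norm_eq_abs])
    have hscale := mulEquivHaarChar_smul_integral_comp (μ := μ) φ fun y => ‖h y‖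
    rw [hnorm, NNReal.smul_def, smul_eq_mul, ← mul_assoc] at hscale
    exact (mul_eq_right₀ hpos.ne').1 hscale
  have hcx : ∀ᵐ y ∂μ, h (φ (x⁻¹ * y)) = c • h (x⁻¹ * y) :=
    (measurePreserving_mul_left μ x⁻¹).quasiMeasurePreserving.ae hc
  have hdist : ∫ y, ‖h (φ y) - h ((φ x)⁻¹ * φ y)‖ ∂μ = |c| * translateDist μ h x := by
    rw [translateDist, ← integral_const_mul]
    refine integral_congr_ae ?_
    filter_upwards [hc, hcx] with y hy hxy
    rw [← map_inv, ← map_mul, hy, hxy, ← smul_sub, norm_smul, Real.norm_eq_abs]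
  rw [translateDist, ← mulEquivHaarChar_smul_integral_comp φ, hdist, NNReal.smul_def, smul_eq_mul,
    ← mul_assoc, hχc, one_mul]

theorem isINGroup_of_integrable_conj [T2Space G] (hh : Integrable h μ) (hne : ¬ h =ᵐ[μ] 0)
    (hconj : ∀ t : G, ∃ c : ℝ, ∀ᵐ y ∂μ, h (t * y * t⁻¹) = c • h y) : IsINGroup G := by
  set m := ∫ y, ‖h y‖ ∂μ
  have hpos : 0 < m := by
    refine (integral_nonneg fun y => norm_nonneg (h y)).lt_of_ne' fun h0 => hne ?_
    exact ((integral_eq_zero_iff_of_nonneg (fun y => norm_nonneg (h y)) hh.norm).1 h0).mono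
      fun y hy => norm_eq_zero.1 hy
  obtain ⟨k, hk, hk', hhk⟩ :=
    exists_hasCompactSupport_integral_norm_sub_le hh (show 0 < m / 8 by positivity)
  have hki : Integrable k μ := hk.integrable_of_hasCompactSupport hk'
  have hclose (x : G) := abs_le.1 (abs_translateDist_sub_le hh hki x)
  have hkm : m ≤ m / 8 + ∫ y, ‖k y‖ ∂μ := by
    calc m ≤ ∫ y, (‖h y - k y‖ + ‖k y‖) ∂μ :=
          integral_mono hh.norm ((hh.sub hki).norm.add hki.norm) fun y => norm_le_norm_sub_add _ _
      _ = ∫ y, ‖h y - k y‖ ∂μ + ∫ y, ‖k y‖ ∂μ := integral_add (hh.sub hki).norm hki.norm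
      _ ≤ m / 8 + ∫ y, ‖k y‖ ∂μ := by gcongr
  refine isINGroup_of_conj_invariant_set (K := {x | translateDist μ h x ≤ m})
    (L := (fun p : G × G => p.1 / p.2) '' (tsupport k ×ˢ tsupport k)) ?_
    ((hk'.isCompact.prod hk'.isCompact).image (by fun_prop)) (fun x hx => ?_) fun t x hx => ?_
  · have hk1 : translateDist μ k 1 = 0 := by simp [translateDist]
    have hsmall : ∀ᶠ x in 𝓝 1, translateDist μ k x < m / 8 :=
      (continuous_translateDist hk hk').continuousAt.eventually_lt_const (by linarith)
    exact hsmall.mono fun x hx => show translateDist μ h x ≤ m by linarith [(hclose x).2]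
  · by_contra hxk
    have hxm : translateDist μ h x ≤ m := hx
    have hfar := translateDist_of_notMem_support_div hki (x := x) fun ⟨y, hy, z, hz, hyz⟩ =>
      hxk ⟨(y, z), ⟨subset_tsupport k hy, subset_tsupport k hz⟩, hyz⟩
    linarith [(hclose x).1]
  · obtain ⟨c, hc⟩ := hconj t
    exact (translateDist_continuousMulEquiv (φ := conjContinuousMulEquiv t) hpos hc x).trans_le hx

end TranslateDist

section RightInvariant

variable {G : Type*} [Group G] [TopologicalSpace G] [IsTopologicalGroup G] [LocallyCompactSpace G]
  [MeasurableSpace G] [BorelSpace G]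

theorem exists_continuous_integral_eq_integral_mul (μ ν : Measure G) [μ.IsHaarMeasure]
    [IsFiniteMeasureOnCompacts ν] [ν.IsMulRightInvariant] [ν.IsOpenPosMeasure] :
    ∃ D : G → ℝ, Continuous D ∧ ∀ ψ : G → ℝ, Continuous ψ → HasCompactSupport ψ →
      ∫ y, ψ y ∂ν = ∫ y, ψ y * D y ∂μ := by
  obtain ⟨⟨g, hg⟩, hg' : HasCompactSupport g, hg0 : 0 ≤ g, hg1 : g 1 ≠ 0⟩ :=
    exists_continuous_nonneg_pos (1 : G)
  have hgpos : 0 < ∫ x, g x ∂μ := hg.integral_pos_of_hasCompactSupport_nonneg_nonzero hg' hg0 hg1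
  set D : G → ℝ := fun y => ∫ z, g (z⁻¹ * y) ∂ν
  have hD : Continuous D := continuous_integral_apply_inv_mul hg hg'
  have hD0 (y : G) : D y ≠ 0 :=
    (Continuous.integral_pos_of_hasCompactSupport_nonneg_nonzero (x := y) (by fun_prop)
      (hg'.comp_homeomorph ((Homeomorph.inv G).trans (Homeomorph.mulRight y)))
      (fun z => hg0 (z⁻¹ * y)) (by simpa using hg1)).ne'
  refine ⟨fun y => D y * (∫ x, g x ∂μ)⁻¹, by fun_prop, fun ψ hψ hψ' => ?_⟩
  have hcombo := Measure.integral_isMulLeftInvariant_isMulRightInvariant_combo (μ := μ) (ν := ν)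
    (hψ.mul hD) hψ'.mul_right hg hg' hg0 hg1
  simp_rw [← mul_assoc, integral_mul_const]
  rw [eq_mul_inv_iff_mul_eq₀ hgpos.ne']
  refine Eq.trans ?_ hcombo.symm
  congr with y
  exact (mul_inv_cancel_right₀ (hD0 y) _).symm

variable [T2Space G]

theorem exists_continuous_measure_le_mul (μ ν : Measure G) [μ.IsHaarMeasure] [μ.Regular]
    [ν.Regular] [ν.IsMulRightInvariant] [ν.IsOpenPosMeasure] :
    ∃ D : G → ℝ, Continuous D ∧
      ∀ (M : NNReal) (s : Set G), (∀ y ∈ s, D y < M) → ν s ≤ M * μ s := by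
  obtain ⟨D, hD, hDint⟩ := exists_continuous_integral_eq_integral_mul μ ν
  refine ⟨D, hD, fun M s hs => ?_⟩
  refine measure_le_of_integral_hasCompactSupport_le (μ := M • μ) (U := {y | D y < M})
    (isOpen_lt hD continuous_const) (fun ψ hψ hψ' hψ0 hψD => ?_) hs
  rw [hDint ψ hψ hψ', integral_smul_nnreal_measure, NNReal.smul_def, smul_eq_mul,
    ← integral_const_mul]
  refine integral_mono ((hψ.mul hD).integrable_of_hasCompactSupport hψ'.mul_right)
    ((hψ.integrable_of_hasCompactSupport hψ').const_mul _) fun y => ?_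
  by_cases hy : y ∈ tsupport ψ
  · have hDy : D y < M := hψD hy
    simpa only [mul_comm] using mul_le_mul_of_nonneg_right hDy.le (hψ0 y)
  · simp [image_eq_zero_of_notMem_tsupport hy]

theorem absolutelyContinuous_of_isMulRightInvariant (μ ν : Measure G) [μ.IsHaarMeasure]
    [μ.Regular] [ν.Regular] [ν.IsMulRightInvariant] [ν.IsOpenPosMeasure] : ν ≪ μ := by
  obtain ⟨D, -, hνμ⟩ := exists_continuous_measure_le_mul μ ν
  intro s hs
  have hcover : s ⊆ ⋃ n : ℕ, s ∩ {y | D y < n} := fun y hy =>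
    Set.mem_iUnion.2 <| (exists_nat_gt (D y)).imp fun n hn => ⟨hy, hn⟩
  refine measure_mono_null hcover <| measure_iUnion_null fun n => nonpos_iff_eq_zero.1 ?_
  calc ν (s ∩ {y | D y < n}) ≤ (n : NNReal) * μ (s ∩ {y | D y < n}) :=
        hνμ n _ fun y hy => by simpa using hy.2
    _ = 0 := by rw [measure_mono_null Set.inter_subset_left hs, mul_zero]

theorem locallyIntegrable_of_isMulRightInvariant {μ ν : Measure G} [μ.IsHaarMeasure] [μ.Regular]
    [ν.Regular] [ν.IsMulRightInvariant] [ν.IsOpenPosMeasure] {E : Type*} [NormedAddCommGroup E]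
    {F : G → E} (hF : LocallyIntegrable F μ) : LocallyIntegrable F ν := by
  obtain ⟨D, hD, hνμ⟩ := exists_continuous_measure_le_mul μ ν
  intro x
  obtain ⟨V, hV, hFV⟩ := hF x
  obtain ⟨M, hM⟩ : ∃ M : NNReal, D x < M :=
    ⟨(D x + 1).toNNReal, (lt_add_one _).trans_le (Real.le_coe_toNNReal _)⟩
  refine ⟨V ∩ {y | D y < M}, inter_mem hV (hD.continuousAt.eventually_lt_const hM), ?_⟩
  have hle : ν.restrict (V ∩ {y | D y < M}) ≤ (M : ENNReal) • μ.restrict (V ∩ {y | D y < M}) := by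
    refine Measure.le_iff.2 fun s hs => ?_
    rw [Measure.restrict_apply hs, Measure.smul_apply, Measure.restrict_apply hs, smul_eq_mul]
    exact hνμ M _ fun y hy => hy.2.2
  exact ((hFV.mono_set Set.inter_subset_left).smul_measure ENNReal.coe_ne_top).mono_measure hle

theorem inv_absolutelyContinuous (μ : Measure G) [μ.IsHaarMeasure] [μ.Regular] : μ.inv ≪ μ :=
  absolutelyContinuous_of_isMulRightInvariant μ μ.inv

theorem absolutelyContinuous_inv (μ : Measure G) [μ.IsHaarMeasure] [μ.Regular] : μ ≪ μ.inv := by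
  intro s hs
  rw [Measure.inv_apply] at hs
  simpa using inv_absolutelyContinuous μ hs

theorem quasiMeasurePreserving_inv_of_regular (μ : Measure G) [μ.IsHaarMeasure] [μ.Regular] :
    Measure.QuasiMeasurePreserving (Inv.inv : G → G) μ μ :=
  ⟨measurable_inv, inv_absolutelyContinuous μ⟩

end RightInvariant

section Weight

variable {G : Type*} [Group G] [MeasurableSpace G] {w : G → ℝ}

theorem IsWeight.one_le_inv_mul (hw : IsWeight w) (x : G) : 1 ≤ w x⁻¹ * w x := by
  refine le_of_mul_le_mul_left ?_ (hw.pos x)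
  calc w x * 1 = w (x * (x⁻¹ * x)) := by group
    _ ≤ w x * w (x⁻¹ * x) := hw.mul_le _ _
    _ ≤ w x * (w x⁻¹ * w x) := mul_le_mul_of_nonneg_left (hw.mul_le _ _) (hw.pos x).le

theorem IsWeight.le_mul_conj (hw : IsWeight w) (t y : G) :
    w y ≤ w t⁻¹ * w t * w (t * y * t⁻¹) := by
  calc w y = w (t⁻¹ * (t * y * t⁻¹) * t) := by group
    _ ≤ w (t⁻¹ * (t * y * t⁻¹)) * w t := hw.mul_le _ _
    _ ≤ w t⁻¹ * w (t * y * t⁻¹) * w t := mul_le_mul_of_nonneg_right (hw.mul_le _ _) (hw.pos t).le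
    _ = w t⁻¹ * w t * w (t * y * t⁻¹) := by ring

variable [TopologicalSpace G] [IsTopologicalGroup G] [LocallyCompactSpace G] [BorelSpace G]

/-- On a set `s` of positive Haar measure `x ↦ max (w x) (w x⁻¹)` is bounded, hence so is `w` on
`s / s`, which is a neighbourhood of `1` by Steinhaus. -/
theorem IsWeight.exists_eventually_nhds_one_le (hw : IsWeight w) :
    ∃ M : ℝ, ∀ᶠ x in 𝓝 1, w x ≤ M := by
  obtain ⟨K, hK1, hK, hKc⟩ := exists_mem_nhds_isCompact_isClosed (1 : G)
  let s : ℕ → Set G := fun n => K ∩ ({x | w x ≤ n} ∩ {x | w x⁻¹ ≤ n})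
  have hs (n : ℕ) : MeasurableSet (s n) :=
    hKc.measurableSet.inter ((measurableSet_le hw.measurable measurable_const).inter
      (measurableSet_le (hw.measurable.comp measurable_inv) measurable_const))
  have hKs : K ⊆ ⋃ n, s n := fun x hx => by
    obtain ⟨n, hn⟩ := exists_nat_ge (max (w x) (w x⁻¹))
    exact Set.mem_iUnion.2 ⟨n, hx, (le_max_left _ _).trans hn, (le_max_right _ _).trans hn⟩
  obtain ⟨n, hn⟩ : ∃ n, 0 < Measure.haar (s n) :=
    exists_measure_pos_of_not_measure_iUnion_null fun h =>
      (Measure.measure_pos_of_mem_nhds _ hK1).ne' (measure_mono_null hKs h)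
  refine ⟨n * n, mem_of_superset (Measure.div_mem_nhds_one_of_haar_pos_ne_top _ (s n) (hs n) hn
    (measure_ne_top_of_subset Set.inter_subset_left hK.measure_ne_top)) ?_⟩
  rintro _ ⟨x, hx, y, hy, rfl⟩
  calc w (x / y) ≤ w x * w y⁻¹ := div_eq_mul_inv x y ▸ hw.mul_le _ _
    _ ≤ n * n := mul_le_mul hx.2.1 hy.2.2 (hw.pos _).le n.cast_nonneg

theorem IsWeight.exists_eventually_nhds_le (hw : IsWeight w) (x : G) :
    ∃ M : ℝ, ∀ᶠ y in 𝓝 x, w y ≤ M := by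
  obtain ⟨M, hM⟩ := hw.exists_eventually_nhds_one_le
  have htendsto : Tendsto (fun y => x⁻¹ * y) (𝓝 x) (𝓝 1) :=
    (continuous_const_mul x⁻¹).tendsto' x 1 (inv_mul_cancel x)
  refine ⟨w x * M, (htendsto.eventually hM).mono fun y hy => ?_⟩
  calc w y = w (x * (x⁻¹ * y)) := by group
    _ ≤ w x * w (x⁻¹ * y) := hw.mul_le _ _
    _ ≤ w x * M := mul_le_mul_of_nonneg_left hy (hw.pos x).le

theorem IsWeight.locallyIntegrable (hw : IsWeight w) (μ : Measure G) [IsLocallyFiniteMeasure μ] :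
    LocallyIntegrable w μ := fun x => by
  obtain ⟨M, hM⟩ := hw.exists_eventually_nhds_le x
  refine (μ.finiteAt_nhds x).integrableAtFilter
    hw.measurable.stronglyMeasurable.aestronglyMeasurable.stronglyMeasurableAtFilter
    ⟨M, eventually_map.2 <| hM.mono fun y hy => ?_⟩
  rwa [Function.comp_apply, Real.norm_of_nonneg (hw.pos y).le]

end Weight

section WeightedMeasure

variable {X E : Type*} [MeasurableSpace X] {w : X → ℝ} {μ : Measure X} [NormedAddCommGroup E]

theorem absolutelyContinuous_weightedMeasure (hw : Measurable w) (hpos : ∀ x, 0 < w x) :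
    μ ≪ weightedMeasure μ w :=
  withDensity_absolutelyContinuous' hw.ennreal_ofReal.aemeasurable
    (.of_forall fun x => by simpa using hpos x)

theorem integrable_weightedMeasure_iff [NormedSpace ℝ E] (hw : Measurable w)
    (hnonneg : ∀ x, 0 ≤ w x) {F : X → E} :
    Integrable F (weightedMeasure μ w) ↔ Integrable (fun x => w x • F x) μ := by
  refine (integrable_withDensity_iff_integrable_smul hw.real_toNNReal).trans ?_
  simp only [NNReal.smul_def, Real.coe_toNNReal _ (hnonneg _)]

end WeightedMeasure

section BeurlingIntegrable

variable {G E : Type*} [Group G] [TopologicalSpace G] [IsTopologicalGroup G] [LocallyCompactSpace G]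
  [MeasurableSpace G] [BorelSpace G] {μ : Measure G} {w : G → ℝ} [NormedAddCommGroup E]
  [NormedSpace ℝ E] {F : G → E}

theorem IsWeight.locallyIntegrable_of_integrable (hw : IsWeight w)
    (hF : Integrable F (weightedMeasure μ w)) : LocallyIntegrable F μ := fun x => by
  obtain ⟨M, hM⟩ := hw.exists_eventually_nhds_le x⁻¹
  obtain ⟨V, hVM, hV, hxV⟩ := eventually_nhds_iff.1 (tendsto_inv x |>.eventually hM)
  rw [integrable_weightedMeasure_iff hw.measurable fun x => (hw.pos x).le] at hF
  refine ⟨V, hV.mem_nhds hxV, ?_⟩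
  have hbound : ∀ᵐ y ∂μ.restrict V, ‖(w y)⁻¹‖ ≤ M :=
    (ae_restrict_mem hV.measurableSet).mono fun y hy => by
      rw [Real.norm_of_nonneg (inv_nonneg.2 (hw.pos y).le), inv_le_iff_one_le_mul₀ (hw.pos y)]
      exact (hw.one_le_inv_mul y).trans (mul_le_mul_of_nonneg_right (hVM y hy) (hw.pos y).le)
  refine (hF.integrableOn.bdd_smul M hw.measurable.inv.aestronglyMeasurable hbound).congr
    (.of_forall fun y => ?_)
  exact inv_smul_smul₀ (hw.pos y).ne' (F y)

theorem IsWeight.integrable_conj [μ.IsHaarMeasure] [μ.Regular] (hw : IsWeight w)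
    (hF : Integrable F (weightedMeasure μ w)) (t : G) :
    Integrable (fun y => F (t * y * t⁻¹)) (weightedMeasure μ w) := by
  rw [integrable_weightedMeasure_iff hw.measurable fun x => (hw.pos x).le] at hF ⊢
  have hconj : Measurable fun y => w (t * y * t⁻¹) :=
    hw.measurable.comp (conjContinuousMulEquiv t).continuous.measurable
  refine ((integrable_comp_continuousMulEquiv (conjContinuousMulEquiv t) hF).bdd_smul
    (φ := fun y => w y * (w (t * y * t⁻¹))⁻¹) (w t⁻¹ * w t)
    (hw.measurable.mul hconj.inv).aestronglyMeasurable (.of_forall fun y => ?_)).congr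
    (.of_forall fun y => ?_)
  · rw [Real.norm_of_nonneg (mul_pos (hw.pos _) (inv_pos.2 (hw.pos _))).le,
      mul_inv_le_iff₀ (hw.pos _)]
    exact hw.le_mul_conj t y
  · simp only [Pi.smul_apply', conjContinuousMulEquiv_apply, mul_smul,
      inv_smul_smul₀ (hw.pos _).ne']

variable [T2Space G]

theorem IsWeight.integrable_hasCompactSupport_smul_const [IsLocallyFiniteMeasure μ]
    (hw : IsWeight w) {φ : G → ℝ} (hφ : Continuous φ) (hφ' : HasCompactSupport φ) (a : E) :
    Integrable (fun y => φ y • a) (weightedMeasure μ w) := by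
  rw [integrable_weightedMeasure_iff hw.measurable fun x => (hw.pos x).le]
  simp_rw [smul_smul]
  exact ((hw.locallyIntegrable μ).integrable_smul_right_of_hasCompactSupport hφ hφ').smul_const a

variable [CompleteSpace E] [μ.IsHaarMeasure] [μ.Regular]

/-- Both sides have the same integrals against test functions: those of `F` are invariant under
conjugation, while `μ` is scaled by `mulEquivHaarChar`. -/
theorem IsWeight.ae_conj_eq_smul_of_integral_conj (hw : IsWeight w)
    (hF : Integrable F (weightedMeasure μ w)) (t : G)
    (hinv : ∀ ψ : G → ℝ, Continuous ψ → HasCompactSupport ψ →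
      ∫ y, ψ (t⁻¹ * y * t) • F y ∂μ = ∫ y, ψ y • F y ∂μ) :
    ∀ᵐ y ∂μ, F y = (mulEquivHaarChar (conjContinuousMulEquiv t) : ℝ) • F (t * y * t⁻¹) := by
  set χ : ℝ := ((mulEquivHaarChar (conjContinuousMulEquiv t) : NNReal) : ℝ)
  have hFt := hw.integrable_conj hF t
  have hdiff : Integrable (fun y => F y - χ • F (t * y * t⁻¹)) (weightedMeasure μ w) :=
    hF.sub (hFt.smul χ)
  have hzero (ψ : G → ℝ) (hψ : Continuous ψ) (hψ' : HasCompactSupport ψ) :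
      ∫ y, ψ y • (F y - χ • F (t * y * t⁻¹)) ∂μ = 0 := by
    have hcancel (y : G) : t⁻¹ * (t * y * t⁻¹) * t = y := by group
    have hscale : χ • ∫ y, ψ y • F (t * y * t⁻¹) ∂μ = ∫ y, ψ y • F y ∂μ := by
      simpa only [conjContinuousMulEquiv_apply, hcancel, hinv ψ hψ hψ', NNReal.smul_def] using
        mulEquivHaarChar_smul_integral_comp (μ := μ) (conjContinuousMulEquiv t)
          fun y => ψ (t⁻¹ * y * t) • F y
    have hψF := (hw.locallyIntegrable_of_integrable hF).integrable_smul_left_of_hasCompactSupport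
      hψ hψ'
    have hψFt := (hw.locallyIntegrable_of_integrable hFt).integrable_smul_left_of_hasCompactSupport
      hψ hψ'
    simp_rw [smul_sub, smul_comm (ψ _) χ]
    rw [integral_sub hψF (hψFt.fun_smul χ), integral_smul, hscale, sub_self]
  have hw0 (x : G) : w x ≠ 0 := (hw.pos x).ne'
  have hsub : (fun y => F y - χ • F (t * y * t⁻¹)) =ᵐ[μ] 0 :=
    ae_eq_zero_of_ae_hasCompactSupport_smul_eq_zero hw0
      ((integrable_weightedMeasure_iff hw.measurable fun x => (hw.pos x).le).1 hdiff)
      fun _ => ae_smul_eq_zero_of_integral_hasCompactSupport_smul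
        (hw.locallyIntegrable_of_integrable hdiff) hzero
  exact hsub.mono fun y hy => sub_eq_zero.1 hy

end BeurlingIntegrable

section MulConst

variable {X A : Type*} [MeasurableSpace X] {μ : Measure X} [NonUnitalNormedRing A]
  [NormedSpace ℂ A] [IsScalarTower ℂ A A] [SMulCommClass ℂ A A] {F : X → A}

theorem integrable_nonUnital_mul_const (hF : Integrable F μ) (a : A) :
    Integrable (fun y => F y * a) μ :=
  ((ContinuousLinearMap.mul ℂ A).flip a).integrable_comp hF

theorem integrable_nonUnital_const_mul (hF : Integrable F μ) (a : A) :
    Integrable (fun y => a * F y) μ :=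
  (ContinuousLinearMap.mul ℂ A a).integrable_comp hF

variable [CompleteSpace A]

theorem integral_nonUnital_mul_const (hF : Integrable F μ) (a : A) :
    ∫ y, F y * a ∂μ = (∫ y, F y ∂μ) * a :=
  ((ContinuousLinearMap.mul ℂ A).flip a).integral_comp_comm hF

theorem integral_nonUnital_const_mul (hF : Integrable F μ) (a : A) :
    ∫ y, a * F y ∂μ = a * ∫ y, F y ∂μ :=
  (ContinuousLinearMap.mul ℂ A a).integral_comp_comm hF

end MulConst

section TestFunctions

variable {X Y E : Type*} [TopologicalSpace X] [LocallyCompactSpace X] [TopologicalSpace Y]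
  [MeasurableSpace Y] [OpensMeasurableSpace Y] [NormedAddCommGroup E] [NormedSpace ℝ E]
  {μ : Measure Y}

theorem continuous_integral_smul_of_locally_hasCompactSupport {F : Y → E}
    (hF : LocallyIntegrable F μ) {Φ : X → Y → ℝ} (hΦ : Continuous Φ.uncurry)
    (hΦ' : ∀ s : Set X, IsCompact s → ∃ K : Set Y, IsCompact K ∧ ∀ x ∈ s, ∀ y ∉ K, Φ x y = 0) :
    Continuous fun x => ∫ y, Φ x y • F y ∂μ := by
  refine continuous_iff_continuousAt.2 fun x₀ => ?_
  obtain ⟨s, hs, hx₀⟩ := exists_compact_mem_nhds x₀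
  obtain ⟨K, hK, hKs⟩ := hΦ' s hs
  exact (continuousOn_integral_bilinear_of_locally_integrable_of_compact_support
    (ContinuousLinearMap.lsmul ℝ ℝ (E := E)).flip hK hΦ.continuousOn
    (fun x y hx hy => hKs x hx y hy) (hF.integrableOn_isCompact hK)).continuousAt hx₀

end TestFunctions

section Convolution

variable {G A : Type*} [Group G] [MeasurableSpace G] [NonUnitalNormedRing A] [NormedSpace ℂ A]
  {μ : Measure G} {f g : G → A} {φ : G → ℝ} {a : A}

theorem beurlingConv_const_smul [MeasurableMul G] [MeasurableInv G] [μ.IsMulLeftInvariant]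
    [IsScalarTower ℂ A A] (hg : g =ᵐ[μ] fun y => φ y • a) (x : G) :
    beurlingConv μ g f x = ∫ y, φ (x * y⁻¹) • (a * f y) ∂μ.inv := by
  refine Eq.trans ?_ ((MeasurableEquiv.inv G).measurableEmbedding.integral_map _).symm
  refine integral_congr_ae
    (((measurePreserving_mul_left μ x).quasiMeasurePreserving.ae hg).mono fun y hy => ?_)
  simp only [hy, smul_mul_assoc, MeasurableEquiv.inv_apply, inv_inv]

variable [TopologicalSpace G] [IsTopologicalGroup G] [LocallyCompactSpace G] [T2Space G]
  [BorelSpace G] [μ.IsHaarMeasure] [μ.Regular] [SMulCommClass ℂ A A]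

theorem beurlingConv_smul_const (hg : g =ᵐ[μ] fun y => φ y • a) (x : G) :
    beurlingConv μ f g x = ∫ y, φ (y⁻¹ * x) • (f y * a) ∂μ := by
  rw [← integral_mul_left_eq_self _ x]
  refine integral_congr_ae (((quasiMeasurePreserving_inv_of_regular μ).ae hg).mono fun y hy => ?_)
  simp only [hy, mul_smul_comm, mul_inv_rev, inv_mul_cancel_right]

end Convolution

section Center

variable {G A : Type*} [Group G] [TopologicalSpace G] [IsTopologicalGroup G]
  [LocallyCompactSpace G] [T2Space G] [MeasurableSpace G] [BorelSpace G] [NonUnitalNormedRing A]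
  [NormedSpace ℂ A] [IsScalarTower ℂ A A] [SMulCommClass ℂ A A] {μ : Measure G} [μ.IsHaarMeasure]
  [μ.Regular] {w : G → ℝ} {f : BeurlingSpace μ w A} {φ ψ : G → ℝ}

/-- This is `f * (φ ⊗ a) = (φ ⊗ a) * f`. It holds everywhere rather than almost everywhere because
both convolutions are continuous. -/
theorem integral_eq_of_mem_beurlingCenter (hw : IsWeight w) (hf : f ∈ beurlingCenter μ w A)
    (hφ : Continuous φ) (hφ' : HasCompactSupport φ) (a : A) (x : G) :
    ∫ y, φ (y⁻¹ * x) • (f y * a) ∂μ = ∫ y, φ (x * y⁻¹) • (a * f y) ∂μ.inv := by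
  have hfi := L1.integrable_coeFn f
  have hg := hw.integrable_hasCompactSupport_smul_const (μ := μ) hφ hφ' a
  have hμ : μ ≪ weightedMeasure μ w := absolutelyContinuous_weightedMeasure hw.measurable hw.pos
  have hcomm := hμ.ae_eq (hf hg.toL1)
  rw [funext (beurlingConv_smul_const (hμ.ae_eq hg.coeFn_toL1)),
    funext (beurlingConv_const_smul (hμ.ae_eq hg.coeFn_toL1)), Continuous.ae_eq_iff_eq] at hcomm
  · exact congrFun hcomm x
  · refine continuous_integral_smul_of_locally_hasCompactSupport
      (hw.locallyIntegrable_of_integrable (integrable_nonUnital_mul_const hfi a))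
      (Φ := fun x y => φ (y⁻¹ * x)) (by fun_prop)
      fun s hs => ⟨(fun p : G × G => p.1 * p.2⁻¹) '' (s ×ˢ tsupport φ),
        (hs.prod hφ').image (by fun_prop), fun x hx y hy => ?_⟩
    exact image_eq_zero_of_notMem_tsupport fun h => hy ⟨(x, y⁻¹ * x), ⟨hx, h⟩, by simp⟩
  · refine continuous_integral_smul_of_locally_hasCompactSupport
      (locallyIntegrable_of_isMulRightInvariant
        (hw.locallyIntegrable_of_integrable (integrable_nonUnital_const_mul hfi a)))
      (Φ := fun x y => φ (x * y⁻¹)) (by fun_prop)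
      fun s hs => ⟨(fun p : G × G => p.2⁻¹ * p.1) '' (s ×ˢ tsupport φ),
        (hs.prod hφ').image (by fun_prop), fun x hx y hy => ?_⟩
    exact image_eq_zero_of_notMem_tsupport fun h => hy ⟨(x, x * y⁻¹), ⟨hx, h⟩, by simp⟩

theorem integral_conj_of_mem_beurlingCenter (hw : IsWeight w) (hf : f ∈ beurlingCenter μ w A)
    (hψ : Continuous ψ) (hψ' : HasCompactSupport ψ) (a : A) (t : G) :
    ∫ y, ψ y • (f y * a) ∂μ = ∫ y, ψ (t * y * t⁻¹) • (a * f y) ∂μ.inv := by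
  have h := integral_eq_of_mem_beurlingCenter hw hf (φ := fun z => ψ (t * z⁻¹)) (by fun_prop)
    (hψ'.comp_homeomorph ((Homeomorph.inv G).trans (Homeomorph.mulLeft t))) a t
  simpa only [mul_inv_rev, inv_inv, mul_inv_cancel_left, mul_assoc] using h

theorem integral_conj_eq_of_mem_beurlingCenter (hw : IsWeight w) (hf : f ∈ beurlingCenter μ w A)
    (hψ : Continuous ψ) (hψ' : HasCompactSupport ψ) (a : A) (t : G) :
    ∫ y, ψ (t * y * t⁻¹) • (f y * a) ∂μ = ∫ y, ψ y • (f y * a) ∂μ := by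
  have h := integral_conj_of_mem_beurlingCenter hw hf (ψ := fun y => ψ (t * y * t⁻¹))
    (by fun_prop) (hψ'.comp_homeomorph (conjContinuousMulEquiv t).toHomeomorph) a 1
  simpa only [one_mul, inv_one, mul_one,
    ← integral_conj_of_mem_beurlingCenter hw hf hψ hψ' a t] using h

variable [CompleteSpace A]

theorem exists_conj_ae_eq_smul_of_mem_beurlingCenter (hw : IsWeight w)
    (hf : f ∈ beurlingCenter μ w A) (a : A) (t : G) :
    ∃ c : ℝ, ∀ᵐ y ∂μ, f (t * y * t⁻¹) * a = c • (f y * a) := by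
  have hχ : (mulEquivHaarChar (conjContinuousMulEquiv t) : ℝ) ≠ 0 :=
    NNReal.coe_ne_zero.2 (mulEquivHaarChar_pos _).ne'
  have hconj := hw.ae_conj_eq_smul_of_integral_conj
    (integrable_nonUnital_mul_const (L1.integrable_coeFn f) a) t fun ψ hψ hψ' => by
      simpa only [inv_inv] using integral_conj_eq_of_mem_beurlingCenter hw hf hψ hψ' a t⁻¹
  exact ⟨_, hconj.mono fun y hy => (eq_inv_smul_iff₀ hχ).2 hy.symm⟩

theorem ae_const_mul_eq_zero_of_mem_beurlingCenter (hw : IsWeight w)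
    (hf : f ∈ beurlingCenter μ w A) {a : A} (h : ∀ᵐ y ∂μ, f y * a = 0) :
    ∀ᵐ y ∂μ, a * f y = 0 := by
  have haf := integrable_nonUnital_const_mul (L1.integrable_coeFn f) a
  have hzero (ψ : G → ℝ) (hψ : Continuous ψ) (hψ' : HasCompactSupport ψ) :
      ∫ y, ψ y • (a * f y) ∂μ.inv = 0 := by
    have hint := integral_conj_of_mem_beurlingCenter hw hf hψ hψ' a 1
    simp only [one_mul, inv_one, mul_one] at hint
    rw [← hint]
    exact integral_eq_zero_of_ae (h.mono fun y hy => by simp only [hy, smul_zero, Pi.zero_apply])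
  exact ae_eq_zero_of_ae_hasCompactSupport_smul_eq_zero (fun x => (hw.pos x).ne')
    ((integrable_weightedMeasure_iff hw.measurable fun x => (hw.pos x).le).1 haf)
    fun _ hχ hχ' => (absolutelyContinuous_inv μ).ae_le <|
      ae_smul_eq_zero_of_integral_hasCompactSupport_smul (locallyIntegrable_of_isMulRightInvariant
        (hw.locallyIntegrable_of_integrable haf)) hzero hχ hχ'

theorem eq_zero_of_mem_beurlingCenter_of_ae_mul_eq_zero (hw : IsWeight w)
    (hA : ∀ z ∈ Set.center A, (∀ b, b * z = 0) → z = 0) (hf : f ∈ beurlingCenter μ w A)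
    (h : ∀ a : A, ∀ᵐ y ∂μ, f y * a = 0) : f = 0 := by
  have hfi := L1.integrable_coeFn f
  have hac : weightedMeasure μ w ≪ μ := withDensity_absolutelyContinuous _ _
  refine (Lp.eq_zero_iff_ae_eq_zero).2 <|
    hfi.ae_eq_zero_of_forall_setIntegral_eq_zero fun s _ _ => ?_
  have hright (b : A) : (∫ y in s, f y ∂weightedMeasure μ w) * b = 0 := by
    rw [← integral_nonUnital_mul_const hfi.integrableOn]
    exact integral_eq_zero_of_ae (ae_restrict_of_ae (hac.ae_le (h b)))
  have hleft (b : A) : b * ∫ y in s, f y ∂weightedMeasure μ w = 0 := by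
    rw [← integral_nonUnital_const_mul hfi.integrableOn]
    exact integral_eq_zero_of_ae (ae_restrict_of_ae (hac.ae_le
      (ae_const_mul_eq_zero_of_mem_beurlingCenter hw hf (h b))))
  exact hA _ (Semigroup.mem_center_iff.2 fun b => (hleft b).trans (hright b).symm) hleft

end Center

theorem IsBoundedCenterApproxIdentity.eq_zero_of_forall_mul_eq_zero {A : Type*}
    [NonUnitalNormedRing A] {ι : Type*} [Preorder ι] [IsDirectedOrder ι] [Nonempty ι] {a : ι → A}
    (ha : IsBoundedCenterApproxIdentity a) {z : A} (hz : z ∈ Set.center A)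
    (h : ∀ b, b * z = 0) : z = 0 :=
  tendsto_nhds_unique (by simpa only [h] using ha.2 z hz) tendsto_const_nhds

theorem mainTheorem4_general
    {G : Type*} [Group G] [TopologicalSpace G] [IsTopologicalGroup G] [LocallyCompactSpace G]
    [T2Space G] [MeasurableSpace G] [BorelSpace G]
    (μ : Measure G) [μ.IsHaarMeasure] [μ.Regular]
    {w : G → ℝ} (hw : IsWeight w)
    {v : G → ℝ} (hv : Measurable v) (hvpos : ∀ x, 0 < v x) (hvw : ∀ x, v x ≤ w x)
    (hvconj : ∀ x y : G, IsConj x y → v x = v y)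
    {A : Type*} [NonUnitalNormedRing A] [NormedSpace ℂ A] [IsScalarTower ℂ A A]
    [SMulCommClass ℂ A A] [CompleteSpace A]
    (hA : ∀ z ∈ Set.center A, (∀ b, b * z = 0) → z = 0)
    (hZ : ∃ f ∈ beurlingCenter μ w A, f ≠ 0) :
    IsINGroup G := by
  obtain ⟨f, hf, hf0⟩ := hZ
  obtain ⟨b, hb⟩ : ∃ b : A, ¬ ∀ᵐ y ∂μ, f y * b = 0 := by
    by_contra! h
    exact hf0 (eq_zero_of_mem_beurlingCenter_of_ae_mul_eq_zero hw hA hf h)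
  have hwf : Integrable (fun y => w y • (f y * b)) μ :=
    (integrable_weightedMeasure_iff hw.measurable fun x => (hw.pos x).le).1
      (integrable_nonUnital_mul_const (L1.integrable_coeFn f) b)
  have hvf : Integrable (fun y => v y • (f y * b)) μ := by
    refine hwf.mono (hv.stronglyMeasurable.smul
      ((Lp.stronglyMeasurable f).mul_const b)).aestronglyMeasurable (.of_forall fun y => ?_)
    rw [norm_smul, norm_smul, Real.norm_of_nonneg (hvpos y).le, Real.norm_of_nonneg (hw.pos y).le]
    exact mul_le_mul_of_nonneg_right (hvw y) (norm_nonneg _)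
  refine isINGroup_of_integrable_conj hvf (fun h0 => hb (h0.mono fun y hy => ?_)) fun t => ?_
  · exact (smul_eq_zero.1 hy).resolve_left (hvpos y).ne'
  · obtain ⟨c, hc⟩ := exists_conj_ae_eq_smul_of_mem_beurlingCenter hw hf b t
    refine ⟨c, hc.mono fun y hy => ?_⟩
    rw [hy, ← hvconj y (t * y * t⁻¹) (isConj_iff.2 ⟨t, rfl⟩), smul_comm]

theorem mainTheorem4
    {G : Type*} [Group G] [TopologicalSpace G] [IsTopologicalGroup G] [LocallyCompactSpace G]
    [T2Space G] [MeasurableSpace G] [BorelSpace G]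
    (μ : Measure G) [μ.IsHaarMeasure] [μ.Regular]
    (w : G → ℝ) (hw : IsWeight w)
    (hw' : (∀ x y : G, IsConj x y → w x = w y) ∨ (∀ x : G, 1 ≤ w x))
    {A : Type*} [NonUnitalNormedRing A] [NormedSpace ℂ A] [IsScalarTower ℂ A A]
    [SMulCommClass ℂ A A] [CompleteSpace A]
    {ι : Type*} [Preorder ι] [IsDirectedOrder ι] [Nonempty ι]
    (a : ι → A) (ha : IsBoundedCenterApproxIdentity a)
    (hZ : ∃ f ∈ beurlingCenter μ w A, f ≠ 0) :
    IsINGroup G := by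
  have hA : ∀ z ∈ Set.center A, (∀ b, b * z = 0) → z = 0 := fun _ hz =>
    ha.eq_zero_of_forall_mul_eq_zero hz
  rcases hw' with hconj | hone
  · exact mainTheorem4_general μ hw hw.measurable hw.pos (fun _ => le_rfl) hconj hA hZ
  · exact mainTheorem4_general μ hw measurable_const (fun _ => one_pos) hone
      (fun _ _ _ => rfl) hA hZ
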